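/- Work in base $b=4$. For $v\in\mathbb N=\{0,1,2,\dots\}$ let $s(v)$ be the sum of the base-$4$ digits of $v$, and let $F(u)$ be the number of $v\in\mathbb N$ with $v+s(v)=u$. For $n\ge 1$ let $K(n)$ be the smallest $u\in\mathbb N$ with $F(u)=n$, and for $i\in\{0,1,2\}$ let $K_i(n)$ be the smallest $u\in\mathbb N$ with $F(u)=n$ and $u\equiv i\pmod 3$. Let $\tau(n)\in\{0,1,2\}$ be the index with $K(n)=K_{\tau(n)}(n)$. For $n\ge2$ let $B(n)+1$ be the number of base-$4$ digits of $K(n)$, and let $\mathcal B(n)=4^{B(n)}+1$. For $m\ge 2$, $O_{\mathcal B}(m)$ stands for a number of the form $\alpha_1\mathcal B(n_1)+\dots+\alpha_t\mathcal B(n_t)+K_\beta(1)$ with $t\ge1$, $n_1=m$, $\alpha_j\in\{1,2,3\}$, $\beta\in\{0,1,2\}$, $n_1>\dots>n_t$, $n_j\in\{\lfloor n_{j-1}/2\rfloor,\lceil n_{j-1}/2\rceil\}$ for $2\le j\le t$, and $n_t\in\{2,3\}$; and $O_{\mathcal B}(1)$ stands for a number $K_\beta(1)$ with $\beta\in\{0,1,2\}$.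 **Theorem.** Let $d\ge0$ and $n$ be integers. (i) If $\frac{10\cdot4^d+2}{3}\le n<\frac{20\cdot4^d+1}{3}$, put $m=\lceil n/4\rceil$ if $d\ge1$ and $n=\frac{20\cdot4^d-2}{3}$, and $m=\lfloor n/4\rfloor$ otherwise. Then $$\begin{aligned}K_0(n)&=2\mathcal B(n)+\mathcal B(\lfloor n/2\rfloor)+O_{\mathcal B}(m),\\ K_1(n)&=\mathcal B(n)+\mathcal B(\lfloor n/2\rfloor)+O_{\mathcal B}(m),\\ K_2(n)&=3\mathcal B(n)+\mathcal B(\lfloor n/2\rfloor)+O_{\mathcal B}(m),\end{aligned}$$ and $\tau(n)=1$. (ii) If $\frac{20\cdot4^d+1}{3}\le n<\frac{10\cdot4^{d+1}-1}{3}$, put $a=1$ if $n=\frac{20\cdot4^d+1}{3}$ and $a=2$ otherwise, and $m=2$ if $n=7$ and $m=\lfloor n/4\rfloor$ otherwise. Then $$\begin{aligned}K_0(n)&=\mathcal B(n)+\mathcal B(\lceil n/2\rceil)+O_{\mathcal B}(\lfloor (n+1)/4\rfloor),\\ K_1(n)&=2\mathcal B(n)+a\,\mathcal B(\lfloor n/2\rfloor)+O_{\mathcal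 B}(m),\\ K_2(n)&=\mathcal B(n)+a\,\mathcal B(\lfloor n/2\rfloor)+O_{\mathcal B}(m),\end{aligned}$$ and $\tau(n)=2$ if $n$ is odd, $\tau(n)=0$ if $n$ is even. (iii) If $n=\frac{10\cdot4^{d+1}-1}{3}$, then $$\begin{aligned}K_0(n)&=\mathcal B(n)+\mathcal B(\lfloor n/2\rfloor)+O_{\mathcal B}(\lfloor n/4\rfloor),\\ K_1(n)&=2\mathcal B(n)+\mathcal B(\lceil n/2\rceil)+O_{\mathcal B}(\lceil n/4\rceil),\\ K_2(n)&=\mathcal B(n)+\mathcal B(\lceil n/2\rceil)+O_{\mathcal B}(\lceil n/4\rceil),\end{aligned}$$ and $\tau(n)=0$. Consequently, with $\delta_j=\frac{10\cdot4^j-1}{3}$, the sequence $\tau(1),\tau(2),\tau(3),\dots$ consists of the three terms $0,2,2$ followed, for $j=0,1,2,\dots$ in this order, by the blocks $1^{\delta_j},(2,0)^{\delta_j},0$ (here $w^{k}$ is $k$ consecutive copies of $w$). -/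

import Mathlib

namespace Kaprekar

/-- `f v = v + s v`, where `s v` is the sum of the base-`b` digits of `v`. -/
def f (b v : ℕ) : ℕ := v + (Nat.digits b v).sum

/-- The number of generators of `u` (a finite number, since `f b v = u` forces `v ≤ u`). -/
noncomputable def F (b u : ℕ) : ℕ := {v : ℕ | f b v = u}.ncard

/-- The smallest number with exactly `n` generators. -/
noncomputable def K (b n : ℕ) : ℕ := sInf {u : ℕ | F b u = n}

/-- The smallest number congruent to `i` modulo `b - 1` with exactly `n` generators. -/
noncomputable def Ki (b i n : ℕ) : ℕ := sInf {u : ℕ | F b u = n ∧ u ≡ i [MOD (b - 1)]}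

/-- The exponent of the leading power of `b` in `K b n`: the number `K b n` has `B b n + 1`
base-`b` digits. -/
noncomputable def B (b n : ℕ) : ℕ := Nat.log b (K b n)

/-- The quasi-positional unit `b ^ B(n) + 1`. -/
noncomputable def cB (b n : ℕ) : ℕ := b ^ B b n + 1

/-- The index set of residues modulo `b - 1`: all of `0, …, b - 2` for even `b`, the even ones
for odd `b`. -/
def idx (b : ℕ) : Set ℕ := {i | i < b - 1 ∧ (Odd b → Even i)}

/-- The generalized Thue–Morse sequence: for even `b` the `t ≤ b - 2` with `K(n) = K_t(n)`, for
odd `b` the `t ≤ (b - 3) / 2` with `K(n) = K_{2t}(n)`. There is only one such `t`, because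
the numbers `K_i(n)` lie in different residue classes. -/
noncomputable def tau (b n : ℕ) : ℕ :=
  sInf {t : ℕ | if Even b then t ∈ idx b ∧ K b n = Ki b t n
    else 2 * t ∈ idx b ∧ K b n = Ki b (2 * t) n}

/-- The conditions on a quasi-positional expansion
`α₁ 𝓑(n₁) + ⋯ + α_t 𝓑(n_t) + K_β(1)`, coded by the list `[(α₁, n₁), …, (α_t, n_t)]`
and by `β`. -/
structure IsQuasiRep (b : ℕ) (L : List (ℕ × ℕ)) (β : ℕ) : Prop where
  coeff : ∀ p ∈ L, 1 ≤ p.1 ∧ p.1 ≤ if Even b then b - 1 else (b - 1) / 2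
  residue : β ∈ idx b
  halving : L.IsChain fun p q => q.2 < p.2 ∧ (q.2 = p.2 / 2 ∨ q.2 = (p.2 + 1) / 2)
  last : ∀ p ∈ L.getLast?, p.2 = 2 ∨ p.2 = 3

/-- The value `α₁ 𝓑(n₁) + ⋯ + α_t 𝓑(n_t) + K_β(1)`. -/
noncomputable def repValue (b : ℕ) (L : List (ℕ × ℕ)) (β : ℕ) : ℕ :=
  (L.map fun p => p.1 * cB b p.2).sum + Ki b β 1

/-- The leading index `n₁`; an expansion without terms, that is `K_β(1)` alone, has leading
index `1`. -/
def leadIndex : List (ℕ × ℕ) → ℕ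
  | [] => 1
  | p :: _ => p.2

/-- The numbers denoted by `O_𝓑(m)`: the values of the quasi-positional expansions with leading
index `m`. -/
def OB (b m : ℕ) : Set ℕ :=
  {x | ∃ L β, IsQuasiRep b L β ∧ leadIndex L = m ∧ x = repValue b L β}

/-- `u = a₁ 𝓑(n₁) + a₂ 𝓑(n₂) + O_𝓑(m)`. -/
def HasLeadingTerms (b u a₁ n₁ a₂ n₂ m : ℕ) : Prop :=
  ∃ r ∈ OB b m, u = a₁ * cB b n₁ + a₂ * cB b n₂ + r

/-- `δ_j = (10 · 4 ^ j - 1) / 3`; the division is exact. -/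
def delta (j : ℕ) : ℕ := (10 * 4 ^ j - 1) / 3

/-- The word `1^{δ_j}, (2,0)^{δ_j}, 0`. -/
def block (j : ℕ) : List ℕ :=
  List.replicate (delta j) 1 ++ (List.replicate (delta j) [2, 0]).flatten ++ [0]

end Kaprekar

/-!
Let `s` be the digit sum in base `b` and `f v = v + s v`. Replacing a `k`-digit number `w` by its
digitwise complement `b ^ k - 1 - w` turns `f w` into `b ^ k - 1 + (b - 1) k - f w`. Hence a
generator of `u = c (b ^ k + 1) + r` either has leading digit `c` followed by a generator of `r`, or
leading digit `c - 1` followed by the complement of a generator of `r'`, where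
`r + r' + 2 = (b - 1) k`; so `F(u) = F(r) + F(r')`.

In base four the numbers `𝓑(n)` grow so fast that it is cheapest to share the `n` generators evenly
between `r` and `r'`: `K_i(n)` is a digit times `𝓑(n)` plus some `K_j(⌊n / 2⌋)` or
`K_j(⌈n / 2⌉)`. Since `r + r' ≡ 1` modulo `3`, the residues of the two tails are `(0, 1)`,
`(1, 0)` or `(2, 2)`, and the pair with the least sum wins. If both halves prefer `(2, 2)`, then `n`
prefers `(0, 1)`, and conversely. This alternation doubles the ranges; at `n = 4 δ_j + 1 = δ_{j+1}`,
where the two halves lie on different sides of a boundary, the pair `(1, 0)` wins.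
-/

namespace Kaprekar

section Base

variable {b : ℕ}

/-! ### Digit sums and the map `f` -/

lemma digits_sum_eq (hb : 1 < b) (v : ℕ) :
    (Nat.digits b v).sum = v % b + (Nat.digits b (v / b)).sum := by
  rcases Nat.eq_zero_or_pos v with rfl | hv
  · simp
  · rw [Nat.digits_def' hb hv, List.sum_cons]

lemma digits_sum_mul_pow_add (hb : 1 < b) {k c w : ℕ} (hc : c < b) (hw : w < b ^ k) :
    (Nat.digits b (c * b ^ k + w)).sum = c + (Nat.digits b w).sum := by
  induction k generalizing w with
  | zero =>
    obtain rfl : w = 0 := by simpa using hw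
    rcases Nat.eq_zero_or_pos c with rfl | hpos
    · simp
    · simp [Nat.digits_of_lt b c hpos.ne' hc]
  | succ k ih =>
    rw [pow_succ] at hw ⊢
    have hdiv : (c * (b ^ k * b) + w) / b = c * b ^ k + w / b := by
      rw [← mul_assoc, add_comm, Nat.add_mul_div_right _ _ (by omega), add_comm]
    have hmod : (c * (b ^ k * b) + w) % b = w % b := by
      rw [← mul_assoc, add_comm, Nat.add_mul_mod_self_right]
    rw [digits_sum_eq hb, digits_sum_eq hb w, hdiv, hmod, ih (Nat.div_lt_of_lt_mul (by linarith))]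
    ring

lemma digits_sum_add_of_complement (hb : 1 < b) {k w w' : ℕ} (hw : w + w' + 1 = b ^ k) :
    (Nat.digits b w).sum + (Nat.digits b w').sum = (b - 1) * k := by
  induction k generalizing w w' with
  | zero =>
    obtain ⟨rfl, rfl⟩ : w = 0 ∧ w' = 0 := by simpa using hw
    simp
  | succ k ih =>
    rw [pow_succ] at hw
    have hw_eq := Nat.div_add_mod' w b
    have hw'_eq := Nat.div_add_mod' w' b
    have hlt := Nat.mod_lt w (show 0 < b by omega)
    have hlt' := Nat.mod_lt w' (show 0 < b by omega)
    have hsum : (w / b + w' / b) * b + (w % b + w' % b + 1) = b ^ k * b := by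
      rw [add_mul]; omega
    have hdvd : b ∣ w % b + w' % b + 1 :=
      (Nat.dvd_add_right (Dvd.intro_left _ rfl)).1 (hsum ▸ Dvd.intro_left _ rfl)
    have hmod : w % b + w' % b + 1 = b := by
      obtain ⟨e, he⟩ := hdvd
      obtain rfl : e = 1 := by
        have : 0 < e := Nat.pos_of_ne_zero (by rintro rfl; omega)
        have : e < 2 := lt_of_mul_lt_mul_left (a := b) (by omega) (by omega)
        omega
      simpa using he
    have hdiv : w / b + w' / b + 1 = b ^ k :=
      Nat.eq_of_mul_eq_mul_right (show 0 < b by omega) (by rw [add_mul, one_mul]; omega)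
    have hrec := ih hdiv
    rw [digits_sum_eq hb w, digits_sum_eq hb w', mul_add_one]
    omega

lemma le_f (b v : ℕ) : v ≤ f b v := Nat.le_add_right _ _

lemma f_mul_pow_add (hb : 1 < b) {k c w : ℕ} (hc : c < b) (hw : w < b ^ k) :
    f b (c * b ^ k + w) = c * (b ^ k + 1) + f b w := by
  unfold f
  rw [digits_sum_mul_pow_add hb hc hw]
  ring

lemma f_add_f_of_complement (hb : 1 < b) {k w w' : ℕ} (hw : w + w' + 1 = b ^ k) :
    f b w + f b w' + 1 = b ^ k + (b - 1) * k := by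
  have := digits_sum_add_of_complement hb hw
  unfold f
  omega

lemma pow_lt_f (hb : 1 < b) {k v : ℕ} (hv : b ^ k ≤ v) : b ^ k < f b v := by
  rcases hv.lt_or_eq with h | rfl
  · exact h.trans_le (le_f b v)
  · have := f_mul_pow_add hb (k := k) (w := 0) hb (by positivity)
    simp only [one_mul, add_zero] at this
    omega

lemma sub_one_mul_lt_pow (hb : 1 < b) (k : ℕ) : (b - 1) * k < b ^ k := by
  have h := one_add_mul_le_pow_of_sq_nonneg (a := b - 1) zero_le zero_le zero_le k
  rw [Nat.add_sub_cancel' hb.le, Nat.cast_id, mul_comm] at h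
  omega

/-! ### The number of generators -/

lemma finite_setOf_f_eq (b u : ℕ) : {v | f b v = u}.Finite :=
  (Set.finite_Iic u).subset fun v hv => (le_f b v).trans (le_of_eq hv)

lemma F_zero (b : ℕ) : F b 0 = 1 := by
  have : {v | f b v = 0} = {0} := by
    ext v
    refine ⟨fun hv => Nat.le_zero.1 ((le_f b v).trans_eq hv), ?_⟩
    rintro rfl
    simp [f]
  rw [F, this, Set.ncard_singleton]

lemma F_one (hb : 1 < b) : F b 1 = 0 := by
  have : {v | f b v = 1} = ∅ := by
    refine Set.eq_empty_of_forall_notMem fun v (hv : f b v = 1) => ?_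
    have := le_f b v
    obtain rfl | rfl : v = 0 ∨ v = 1 := by omega
    · simp [f] at hv
    · simp [f, Nat.digits_of_lt b 1 one_ne_zero hb] at hv
  rw [F, this, Set.ncard_empty]

lemma eq_or_add_one_eq_of_mul_add_eq {N c d r s : ℕ} (hr : r < N) (hs : s < 2 * N)
    (h : d * N + s = c * N + r) : d = c ∨ d + 1 = c := by
  have hdc : d < c + 1 := lt_of_mul_lt_mul_right (a := N) (by rw [add_mul]; omega) zero_le
  have hcd : c < d + 2 := lt_of_mul_lt_mul_right (a := N) (by rw [add_mul]; omega) zero_le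
  omega

lemma leading_digit_of_f_eq (hb : 1 < b) {k c r v : ℕ} (hr : r ≤ b ^ k)
    (hu : c * (b ^ k + 1) + r ≤ b ^ (k + 1)) (hv : f b v = c * (b ^ k + 1) + r) :
    ∃ d < b, ∃ w < b ^ k, v = d * b ^ k + w ∧
      (d = c ∧ f b w = r ∨ d + 1 = c ∧ f b w = b ^ k + 1 + r) := by
  have hpos : 0 < b ^ k := by positivity
  have hvk : v < b ^ (k + 1) := by
    by_contra h
    exact (hv.trans_le hu).not_gt (pow_lt_f hb (not_lt.1 h))
  have hd : v / b ^ k < b := Nat.div_lt_of_lt_mul (by rwa [pow_succ] at hvk)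
  have hw : v % b ^ k < b ^ k := Nat.mod_lt v hpos
  have hv' : v = v / b ^ k * b ^ k + v % b ^ k := (Nat.div_add_mod' v _).symm
  refine ⟨_, hd, _, hw, hv', ?_⟩
  rw [hv', f_mul_pow_add hb hd hw] at hv
  have hfw : f b (v % b ^ k) < 2 * (b ^ k + 1) := by
    have := f_add_f_of_complement hb (w := v % b ^ k) (w' := b ^ k - 1 - v % b ^ k) (k := k)
      (by omega)
    have := sub_one_mul_lt_pow hb k
    omega
  rcases eq_or_add_one_eq_of_mul_add_eq (Nat.lt_succ_of_le hr) hfw hv with h | h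
  · exact Or.inl ⟨h, by rw [h] at hv; omega⟩
  · refine Or.inr ⟨h, ?_⟩
    rw [← h, add_mul, one_mul] at hv
    omega

/-- A generator with leading part `c - 1` is reflected to its `(b - 1)`-complement `w`. -/
lemma setOf_f_eq_mul_add (hb : 1 < b) {k c r : ℕ} (hc : 1 ≤ c) (hr : r ≤ b ^ k)
    (hu : c * (b ^ k + 1) + r ≤ b ^ (k + 1)) :
    {v | f b v = c * (b ^ k + 1) + r} =
      (fun w => c * b ^ k + w) '' {w | f b w = r} ∪
      (fun w => c * b ^ k - 1 - w) '' {w | f b w + r + 2 = (b - 1) * k} := by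
  obtain ⟨d, rfl⟩ : ∃ d, c = d + 1 := ⟨c - 1, by omega⟩
  have hcb : d + 1 < b := by
    by_contra h
    have := Nat.mul_le_mul_right (b ^ k) (not_lt.1 h)
    rw [pow_succ', mul_add_one] at hu
    omega
  have hcpow : (d + 1) * b ^ k = d * b ^ k + b ^ k := by ring
  ext v
  simp only [Set.mem_ofPred_eq, Set.mem_union, Set.mem_image]
  constructor
  · intro hv
    obtain ⟨e, -, w, hw, rfl, ⟨rfl, hfw⟩ | ⟨he, hfw⟩⟩ := leading_digit_of_f_eq hb hr hu hv
    · exact Or.inl ⟨w, hfw, rfl⟩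
    · obtain rfl : e = d := by omega
      have := f_add_f_of_complement hb (w := w) (w' := b ^ k - 1 - w) (k := k) (by omega)
      exact Or.inr ⟨b ^ k - 1 - w, by omega, by omega⟩
  · rintro (⟨w, rfl, rfl⟩ | ⟨w, hw, rfl⟩)
    · refine f_mul_pow_add hb hcb ?_
      by_contra h
      exact (pow_lt_f hb (not_lt.1 h)).not_ge hr
    · have hwk : w < b ^ k :=
        (le_f b w).trans_lt (lt_of_le_of_lt (by omega) (sub_one_mul_lt_pow hb k))
      have := f_add_f_of_complement hb (w := w) (w' := b ^ k - 1 - w) (k := k) (by omega)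
      rw [show (d + 1) * b ^ k - 1 - w = d * b ^ k + (b ^ k - 1 - w) by omega,
        f_mul_pow_add hb (by omega) (by omega), add_mul d 1]
      omega

lemma F_mul_add_of_lt (hb : 1 < b) {k c r : ℕ} (hc : 1 ≤ c) (hr : r ≤ b ^ k)
    (hu : c * (b ^ k + 1) + r ≤ b ^ (k + 1)) (hkr : (b - 1) * k < r + 2) :
    F b (c * (b ^ k + 1) + r) = F b r := by
  have hempty : {w | f b w + r + 2 = (b - 1) * k} = ∅ :=
    Set.eq_empty_of_forall_notMem fun w (hw : f b w + r + 2 = _) => by omega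
  rw [F, setOf_f_eq_mul_add hb hc hr hu, hempty, Set.image_empty, Set.union_empty,
    Set.ncard_image_of_injective _ (add_right_injective _), F]

lemma F_mul_add_of_add_eq (hb : 1 < b) {k c r r' : ℕ} (hc : 1 ≤ c)
    (hu : c * (b ^ k + 1) + r ≤ b ^ (k + 1)) (hr : r + r' + 2 = (b - 1) * k) :
    F b (c * (b ^ k + 1) + r) = F b r + F b r' := by
  have hk := sub_one_mul_lt_pow hb k
  have hck : b ^ k ≤ c * b ^ k := Nat.le_mul_of_pos_left _ hc
  have hset : {w | f b w + r + 2 = (b - 1) * k} = {w | f b w = r'} := by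
    ext w
    simp only [Set.mem_ofPred_eq]
    omega
  have hinj : Set.InjOn (fun w => c * b ^ k - 1 - w) {w | f b w = r'} := by
    intro x hx y hy hxy
    have := le_f b y
    simp only [Set.mem_ofPred_eq] at hx hy hxy
    omega
  have hdisj : Disjoint ((fun w => c * b ^ k + w) '' {w | f b w = r})
      ((fun w => c * b ^ k - 1 - w) '' {w | f b w = r'}) := by
    rw [Set.disjoint_left]
    rintro _ ⟨w, -, rfl⟩ ⟨w', -, h⟩
    simp only at h
    omega
  rw [F, setOf_f_eq_mul_add hb hc (by omega) hu, hset,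
    Set.ncard_union_eq hdisj ((finite_setOf_f_eq b r).image _) ((finite_setOf_f_eq b r').image _),
    Set.ncard_image_of_injective _ (add_right_injective _), hinj.ncard_image, F, F]

lemma exists_eq_mul_add (hb : 1 < b) {u : ℕ} (hu : 2 ≤ u) :
    ∃ k c r, 1 ≤ c ∧ c < b ∧ r ≤ b ^ k ∧ u ≤ b ^ (k + 1) ∧ u = c * (b ^ k + 1) + r := by
  set k := Nat.log b (u - 1)
  have hle : b ^ k ≤ u - 1 := Nat.pow_log_le_self b (by omega)
  have hlt : u - 1 < b ^ (k + 1) := Nat.lt_pow_succ_log_self hb _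
  have hmod := Nat.mod_lt u (show 0 < b ^ k + 1 by positivity)
  refine ⟨k, u / (b ^ k + 1), u % (b ^ k + 1), ?_, ?_, by omega, by omega,
    (Nat.div_add_mod' u _).symm⟩
  · rw [Nat.le_div_iff_mul_le (by positivity)]
    omega
  · rw [Nat.div_lt_iff_lt_mul (by positivity), mul_add_one, ← pow_succ']
    omega

/-! ### Leading exponents -/

/-- The possible tails `r` of a number `c (b ^ k + 1) + r` whose `n` generators are shared evenly
between `r` and its partner `r'`, so that each has `⌊n / 2⌋` or `⌈n / 2⌉` of them. -/
def tails (b n k : ℕ) : Set ℕ :=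
  {r | ∃ r', r + r' + 2 = (b - 1) * k ∧ F b r + F b r' = n ∧ n / 2 ≤ F b r ∧ n / 2 ≤ F b r'}

lemma tail_lt_pow (hb : 1 < b) {n k t : ℕ} (ht : t ∈ tails b n k) : t + 2 < b ^ k := by
  obtain ⟨t', htt', -⟩ := ht
  have := sub_one_mul_lt_pow hb k
  omega

lemma F_mul_add_tail (hb : 1 < b) {n k c t : ℕ} (hc : 1 ≤ c)
    (hu : c * (b ^ k + 1) + t ≤ b ^ (k + 1)) (ht : t ∈ tails b n k) :
    F b (c * (b ^ k + 1) + t) = n := by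
  obtain ⟨t', htt', hF, -⟩ := ht
  rw [F_mul_add_of_add_eq hb hc hu htt', hF]

lemma K_le {u n : ℕ} (hu : F b u = n) : K b n ≤ u := Nat.sInf_le hu

/-- `k` is the least exponent for which there are balanced tails, and all numbers having
more than `⌈n / 2⌉` but fewer than `n` generators are too large to be tails for `k`. -/
structure IsLeadExponent (b n k : ℕ) : Prop where
  nonempty : (tails b n k).Nonempty
  minimal : ∀ j < k, tails b n j = ∅
  unbalanced : ∀ r, (n + 1) / 2 < F b r → F b r < n → (b - 1) * k < r + 2

namespace IsLeadExponent

variable {n k : ℕ}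

lemma mem_tails (h : IsLeadExponent b n k) {j r r' : ℕ} (hj : j ≤ k)
    (hr : r + r' + 2 = (b - 1) * j) (hF : F b r + F b r' = n) (hpos : 0 < F b r)
    (hpos' : 0 < F b r') : r ∈ tails b n j := by
  have hjk := Nat.mul_le_mul_left (b - 1) hj
  have hle : F b r ≤ (n + 1) / 2 := by
    by_contra hlt
    have := h.unbalanced r (by omega) (by omega)
    omega
  have hle' : F b r' ≤ (n + 1) / 2 := by
    by_contra hlt
    have := h.unbalanced r' (by omega) (by omega)
    omega
  exact ⟨r', hr, hF, by omega, by omega⟩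

lemma pow_lt (h : IsLeadExponent b n k) (hb : 1 < b) (hn : 2 ≤ n) {u : ℕ} (hu : F b u = n) :
    b ^ k < u := by
  induction u using Nat.strong_induction_on with
  | _ u ih =>
    have hu2 : 2 ≤ u := by
      by_contra hlt
      obtain rfl | rfl : u = 0 ∨ u = 1 := by omega
      · rw [F_zero] at hu; omega
      · rw [F_one hb] at hu; omega
    obtain ⟨j, c, r, hc, -, hr, hle, rfl⟩ := exists_eq_mul_add hb hu2
    have hcj : b ^ j + 1 ≤ c * (b ^ j + 1) := Nat.le_mul_of_pos_left _ hc
    rcases lt_or_ge ((b - 1) * j) (r + 2) with hlt | hge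
    · exact (ih r (by omega) ((F_mul_add_of_lt hb hc hr hle hlt).symm.trans hu)).trans (by omega)
    obtain ⟨r', hr'⟩ : ∃ r', r + r' + 2 = (b - 1) * j := ⟨(b - 1) * j - 2 - r, by omega⟩
    have hj := sub_one_mul_lt_pow hb j
    rw [F_mul_add_of_add_eq hb hc hle hr'] at hu
    rcases Nat.eq_zero_or_pos (F b r) with h0 | hpos
    · exact (ih r' (by omega) (by omega)).trans (by omega)
    rcases Nat.eq_zero_or_pos (F b r') with h0 | hpos'
    · exact (ih r (by omega) (by omega)).trans (by omega)
    have hkj : k ≤ j := by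
      by_contra! hjk
      have := h.mem_tails hjk.le hr' hu hpos hpos'
      rwa [h.minimal j hjk] at this
    exact (Nat.pow_le_pow_right (by omega) hkj).trans_lt (by omega)

lemma exists_eq_mul_add_tail (h : IsLeadExponent b n k) (hb : 1 < b) (hn : 2 ≤ n) {u : ℕ}
    (hu : F b u = n) (hle : u ≤ b ^ (k + 1)) :
    ∃ c, 1 ≤ c ∧ c < b ∧ ∃ t ∈ tails b n k, u = c * (b ^ k + 1) + t := by
  have hku := h.pow_lt hb hn hu
  have hpos : 0 < b ^ k := by positivity
  obtain ⟨j, c, r, hc, hcb, hr, huj, rfl⟩ := exists_eq_mul_add hb (show 2 ≤ u by omega)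
  have hcj : b ^ j + 1 ≤ c * (b ^ j + 1) := Nat.le_mul_of_pos_left _ hc
  obtain rfl : j = k := by
    have hkj : k < j + 1 := (Nat.pow_lt_pow_iff_right hb).1 (by omega)
    have hjk : j < k + 1 := (Nat.pow_lt_pow_iff_right hb).1 (by omega)
    omega
  refine ⟨c, hc, hcb, r, ?_, rfl⟩
  have hF {s : ℕ} (hs : s ≤ b ^ j) : F b s ≠ n := fun hn' => (h.pow_lt hb hn hn').not_ge hs
  have hj := sub_one_mul_lt_pow hb j
  rcases lt_or_ge ((b - 1) * j) (r + 2) with hlt | hge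
  · exact absurd ((F_mul_add_of_lt hb hc hr huj hlt).symm.trans hu) (hF hr)
  obtain ⟨r', hr'⟩ : ∃ r', r + r' + 2 = (b - 1) * j := ⟨(b - 1) * j - 2 - r, by omega⟩
  rw [F_mul_add_of_add_eq hb hc huj hr'] at hu
  have hne := hF hr
  have hne' := hF (show r' ≤ b ^ j by omega)
  exact h.mem_tails le_rfl hr' hu (by omega) (by omega)

lemma B_eq (h : IsLeadExponent b n k) (hb : 1 < b) (hn : 2 ≤ n) : B b n = k := by
  obtain ⟨t, ht⟩ := h.nonempty
  have hlt := tail_lt_pow hb ht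
  have htwo : 2 * b ^ k ≤ b ^ (k + 1) := by
    rw [pow_succ']
    exact Nat.mul_le_mul_right _ hb
  have hF : F b (1 * (b ^ k + 1) + t) = n := F_mul_add_tail hb le_rfl (by omega) ht
  have hK : F b (K b n) = n := Nat.sInf_mem (s := {u | F b u = n}) ⟨_, hF⟩
  have hKle := K_le hF
  exact Nat.log_eq_of_pow_le_of_lt_pow (h.pow_lt hb hn hK).le (by omega)

end IsLeadExponent

/-! ### Quasi-positional expansions -/

lemma Ki_one_mem_OB {i : ℕ} (hi : i ∈ idx b) : Ki b i 1 ∈ OB b 1 :=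
  ⟨[], i, ⟨by simp, hi, List.IsChain.nil, by simp⟩, rfl, by simp [repValue]⟩

lemma mul_cB_add_Ki_one_mem_OB {c n i : ℕ} (hc : 1 ≤ c)
    (hc' : c ≤ if Even b then b - 1 else (b - 1) / 2) (hn : n = 2 ∨ n = 3) (hi : i ∈ idx b) :
    c * cB b n + Ki b i 1 ∈ OB b n :=
  ⟨[(c, n)], i, ⟨by simpa using ⟨hc, hc'⟩, hi, List.IsChain.singleton _, by simpa using hn⟩, rfl,
    by simp [repValue]⟩

lemma mul_cB_add_mem_OB {c n m r : ℕ} (hc : 1 ≤ c)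
    (hc' : c ≤ if Even b then b - 1 else (b - 1) / 2) (hm : 2 ≤ m) (hmn : m < n)
    (hhalf : m = n / 2 ∨ m = (n + 1) / 2) (hr : r ∈ OB b m) : c * cB b n + r ∈ OB b n := by
  obtain ⟨L, β, ⟨hcoeff, hres, hchain, hlast⟩, rfl, rfl⟩ := hr
  rcases L with _ | ⟨p, L⟩
  · simp only [leadIndex] at hm
    omega
  refine ⟨(c, n) :: p :: L, β, ⟨?_, hres, hchain.cons_cons ⟨hmn, hhalf⟩, ?_⟩, rfl, ?_⟩
  · exact List.forall_mem_cons.2 ⟨⟨hc, hc'⟩, hcoeff⟩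
  · rwa [List.getLast?_cons_cons]
  · simp only [repValue, List.map_cons, List.sum_cons]
    ring

end Base

/-! ### Splittings in base four -/

/-- Every residue class modulo `3` contains a number with exactly `n` generators in base `4`. -/
def Attained (n : ℕ) : Prop := ∀ i < 3, ∃ u, F 4 u = n ∧ u % 3 = i

lemma Ki_le {n u i : ℕ} (hu : F 4 u = n) (hi : u % 3 = i) : Ki 4 i n ≤ u :=
  Nat.sInf_le ⟨hu, hi ▸ (Nat.mod_modEq u 3).symm⟩

lemma Attained.F_Ki_and_mod {n i : ℕ} (h : Attained n) (hi : i < 3) :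
    F 4 (Ki 4 i n) = n ∧ Ki 4 i n % 3 = i := by
  obtain ⟨u, hu, hui⟩ := h i hi
  obtain ⟨hF, hmod⟩ := Nat.sInf_mem (s := {u | F 4 u = n ∧ u ≡ i [MOD 4 - 1]})
    ⟨u, hu, hui ▸ (Nat.mod_modEq u 3).symm⟩
  exact ⟨hF, Eq.trans hmod (Nat.mod_eq_of_lt hi)⟩

lemma Attained.F_Ki {n i : ℕ} (h : Attained n) (hi : i < 3) : F 4 (Ki 4 i n) = n :=
  (h.F_Ki_and_mod hi).1

lemma Attained.Ki_mod {n i : ℕ} (h : Attained n) (hi : i < 3) : Ki 4 i n % 3 = i :=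
  (h.F_Ki_and_mod hi).2

/-- The least sum `r + r'` of numbers with `⌊n / 2⌋` and `⌈n / 2⌉` generators for which `r ≡ i` and
`r + r' ≡ 1` modulo `3`. The second congruence is forced by `r + r' + 2 = 3 k`. -/
noncomputable def splitSum (n i : ℕ) : ℕ := Ki 4 i (n / 2) + Ki 4 ((4 - i) % 3) ((n + 1) / 2)

lemma splitSum_zero (n : ℕ) : splitSum n 0 = Ki 4 0 (n / 2) + Ki 4 1 ((n + 1) / 2) := rfl

lemma splitSum_one (n : ℕ) : splitSum n 1 = Ki 4 1 (n / 2) + Ki 4 0 ((n + 1) / 2) := rfl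

lemma splitSum_two (n : ℕ) : splitSum n 2 = Ki 4 2 (n / 2) + Ki 4 2 ((n + 1) / 2) := rfl

lemma exists_Ki_le_of_mem_tails {n k t : ℕ} (ht : t ∈ tails 4 n k) :
    ∃ i < 3, ∃ t', t + t' + 2 = 3 * k ∧
      (Ki 4 i (n / 2) ≤ t ∧ Ki 4 ((4 - i) % 3) ((n + 1) / 2) ≤ t' ∨
        Ki 4 ((4 - i) % 3) ((n + 1) / 2) ≤ t ∧ Ki 4 i (n / 2) ≤ t') := by
  obtain ⟨t', htt', hF, hle, hle'⟩ := ht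
  have hmod := Nat.mod_lt t (show 0 < 3 by norm_num)
  have hmod' := Nat.mod_lt t' (show 0 < 3 by norm_num)
  obtain ⟨hFt, hFt'⟩ | ⟨hFt, hFt'⟩ : F 4 t = n / 2 ∧ F 4 t' = (n + 1) / 2 ∨
      F 4 t = (n + 1) / 2 ∧ F 4 t' = n / 2 := by omega
  · exact ⟨t % 3, hmod, t', htt', Or.inl ⟨Ki_le hFt rfl, Ki_le hFt' (by omega)⟩⟩
  · exact ⟨t' % 3, hmod', t', htt', Or.inr ⟨Ki_le hFt (by omega), Ki_le hFt' rfl⟩⟩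

lemma exists_splitSum_le_of_mem_tails {n k t : ℕ} (ht : t ∈ tails 4 n k) :
    ∃ i < 3, splitSum n i + 2 ≤ 3 * k := by
  obtain ⟨i, hi, t', htt', h⟩ := exists_Ki_le_of_mem_tails ht
  exact ⟨i, hi, by unfold splitSum; omega⟩

lemma Ki_mem_tails {n k i : ℕ} (hfloor : Attained (n / 2)) (hceil : Attained ((n + 1) / 2))
    (hi : i < 3) (hk : splitSum n i + 2 = 3 * k) :
    Ki 4 i (n / 2) ∈ tails 4 n k ∧ Ki 4 ((4 - i) % 3) ((n + 1) / 2) ∈ tails 4 n k := by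
  have hF := hfloor.F_Ki hi
  have hF' := hceil.F_Ki (Nat.mod_lt (4 - i) (show 0 < 3 by norm_num))
  unfold splitSum at hk
  exact ⟨⟨_, by omega, by omega, by omega, by omega⟩,
    ⟨Ki 4 i (n / 2), by omega, by omega, by omega, by omega⟩⟩

lemma mul_four_pow_add_mod_three (k c t : ℕ) : (c * (4 ^ k + 1) + t) % 3 = (2 * c + t) % 3 := by
  have hpow : 4 ^ k ≡ 1 [MOD 3] := by
    simpa only [one_pow] using Nat.ModEq.pow k (show 4 ≡ 1 [MOD 3] from rfl)
  rw [mul_comm 2 c]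
  exact ((hpow.add_right 1).mul_left c).add_right t

lemma exists_digit_mod_three (t : ℕ) {i : ℕ} (hi : i < 3) :
    ∃ c, 1 ≤ c ∧ c ≤ 3 ∧ (2 * c + t) % 3 = i := by
  obtain h | h | h : (2 * 1 + t) % 3 = i ∨ (2 * 2 + t) % 3 = i ∨ (2 * 3 + t) % 3 = i := by omega
  exacts [⟨1, by norm_num, by norm_num, h⟩, ⟨2, by norm_num, by norm_num, h⟩,
    ⟨3, by norm_num, by norm_num, h⟩]

lemma mul_add_tail_le {n k c t : ℕ} (hc : c ≤ 3) (ht : t ∈ tails 4 n k) :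
    c * (4 ^ k + 1) + t ≤ 4 ^ (k + 1) := by
  have hcpow := Nat.mul_le_mul_right (4 ^ k + 1) hc
  have hk := sub_one_mul_lt_pow (show 1 < 4 by norm_num) k
  obtain ⟨t', htt', -⟩ := ht
  rw [pow_succ]
  omega

lemma attained_of_mem_tails {n k t : ℕ} (ht : t ∈ tails 4 n k) : Attained n := by
  intro i hi
  obtain ⟨c, hc, hc', hmod⟩ := exists_digit_mod_three t hi
  exact ⟨_, F_mul_add_tail (by norm_num) hc (mul_add_tail_le hc' ht) ht,
    (mul_four_pow_add_mod_three k c t).trans hmod⟩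

lemma Ki_le_mul_cB_add {n i c t : ℕ} (ht : t ∈ tails 4 n (B 4 n)) (hc : 1 ≤ c) (hc' : c ≤ 3)
    (hi : (2 * c + t) % 3 = i) : Ki 4 i n ≤ c * cB 4 n + t :=
  Ki_le (F_mul_add_tail (by norm_num) hc (mul_add_tail_le hc' ht) ht)
    ((mul_four_pow_add_mod_three _ c t).trans hi)

/-- The numbers `K_i(n)` exist and are governed by the balanced splittings of `n`. -/
structure Splits (n : ℕ) : Prop where
  attained_floor : Attained (n / 2)
  attained_ceil : Attained ((n + 1) / 2)
  isLeadExponent : IsLeadExponent 4 n (B 4 n)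

lemma splits_of_attained {n : ℕ} (hn : 2 ≤ n) (hfloor : Attained (n / 2))
    (hceil : Attained ((n + 1) / 2))
    (hlt : ∀ r, (n + 1) / 2 < F 4 r → F 4 r < n → splitSum n 2 < r) : Splits n := by
  have hmod {i : ℕ} (hi : i < 3) : splitSum n i % 3 = 1 := by
    have := hfloor.Ki_mod hi
    have := hceil.Ki_mod (Nat.mod_lt (4 - i) (show 0 < 3 by norm_num))
    unfold splitSum
    omega
  obtain ⟨i, hi, hmin⟩ :=
    (Finset.range 3).exists_min_image (splitSum n) ⟨0, by norm_num⟩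
  simp only [Finset.mem_range] at hi hmin
  obtain ⟨k, hk⟩ : ∃ k, splitSum n i + 2 = 3 * k :=
    ⟨(splitSum n i + 2) / 3, by have := hmod hi; omega⟩
  have hlead : IsLeadExponent 4 n k := by
    refine ⟨⟨_, (Ki_mem_tails hfloor hceil hi hk).1⟩, fun j hj => ?_, fun r hr hr' => ?_⟩
    · refine Set.eq_empty_of_forall_notMem fun t ht => ?_
      obtain ⟨i', hi', hle⟩ := exists_splitSum_le_of_mem_tails ht
      have := hmin i' hi'
      omega
    · have := hlt r hr hr'
      have := hmin 2 (by norm_num)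
      omega
  exact ⟨hfloor, hceil, by rwa [hlead.B_eq (by norm_num) hn]⟩

lemma two_le_cB (n : ℕ) : 2 ≤ cB 4 n := by
  have := Nat.one_le_pow (B 4 n) 4 (by norm_num)
  unfold cB
  omega

namespace Splits

variable {n i : ℕ}

lemma attained (h : Splits n) : Attained n :=
  have ⟨_, ht⟩ := h.isLeadExponent.nonempty
  attained_of_mem_tails ht

lemma three_mul_B_le (h : Splits n) (hi : i < 3) : 3 * B 4 n ≤ splitSum n i + 2 := by
  by_contra! hlt
  have hmod := h.attained_floor.Ki_mod hi
  have hmod' := h.attained_ceil.Ki_mod (Nat.mod_lt (4 - i) (show 0 < 3 by norm_num))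
  have hk : splitSum n i + 2 = 3 * ((splitSum n i + 2) / 3) := by unfold splitSum; omega
  have hmem := (Ki_mem_tails h.attained_floor h.attained_ceil hi hk).1
  rwa [h.isLeadExponent.minimal _ (by omega)] at hmem

lemma mem_tails_iff (h : Splits n) {t : ℕ} :
    t ∈ tails 4 n (B 4 n) ↔ ∃ i < 3, splitSum n i + 2 = 3 * B 4 n ∧
      (t = Ki 4 i (n / 2) ∨ t = Ki 4 ((4 - i) % 3) ((n + 1) / 2)) := by
  constructor
  · intro ht
    obtain ⟨i, hi, t', htt', hle⟩ := exists_Ki_le_of_mem_tails ht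
    have := h.three_mul_B_le hi
    unfold splitSum at this ⊢
    exact ⟨i, hi, by omega, by omega⟩
  · rintro ⟨i, hi, hk, rfl | rfl⟩
    exacts [(Ki_mem_tails h.attained_floor h.attained_ceil hi hk).1,
      (Ki_mem_tails h.attained_floor h.attained_ceil hi hk).2]

lemma eq_Ki_of_mem_tails (h : Splits n) {t : ℕ} (ht : t ∈ tails 4 n (B 4 n)) :
    splitSum n 0 + 2 = 3 * B 4 n ∧ (t = Ki 4 0 (n / 2) ∨ t = Ki 4 1 ((n + 1) / 2)) ∨
    splitSum n 1 + 2 = 3 * B 4 n ∧ (t = Ki 4 1 (n / 2) ∨ t = Ki 4 0 ((n + 1) / 2)) ∨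
    splitSum n 2 + 2 = 3 * B 4 n ∧ (t = Ki 4 2 (n / 2) ∨ t = Ki 4 2 ((n + 1) / 2)) := by
  obtain ⟨i, hi, h⟩ := h.mem_tails_iff.1 ht
  interval_cases i
  exacts [Or.inl h, Or.inr (Or.inl h), Or.inr (Or.inr h)]

lemma exists_splitSum_eq (h : Splits n) : ∃ i < 3, splitSum n i + 2 = 3 * B 4 n :=
  have ⟨_, ht⟩ := h.isLeadExponent.nonempty
  have ⟨i, hi, hk, _⟩ := h.mem_tails_iff.1 ht
  ⟨i, hi, hk⟩

lemma cB_le (h : Splits n) (hn : 2 ≤ n) {u : ℕ} (hu : F 4 u = n) : cB 4 n ≤ u :=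
  h.isLeadExponent.pow_lt (by norm_num) hn hu

lemma exists_Ki_eq (h : Splits n) (hn : 2 ≤ n) (hi : i < 3) :
    ∃ c, 1 ≤ c ∧ c ≤ 3 ∧ ∃ t ∈ tails 4 n (B 4 n),
      (2 * c + t) % 3 = i ∧ Ki 4 i n = c * cB 4 n + t := by
  obtain ⟨t₀, ht₀⟩ := h.isLeadExponent.nonempty
  obtain ⟨c₀, hc₀, hc₀', hmod₀⟩ := exists_digit_mod_three t₀ hi
  have hle : Ki 4 i n ≤ 4 ^ (B 4 n + 1) :=
    (Ki_le_mul_cB_add ht₀ hc₀ hc₀' hmod₀).trans (mul_add_tail_le hc₀' ht₀)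
  obtain ⟨c, hc, hc', t, ht, heq⟩ := h.isLeadExponent.exists_eq_mul_add_tail (by norm_num) hn
    (h.attained.F_Ki hi) hle
  refine ⟨c, hc, by omega, t, ht, ?_, heq⟩
  rw [← mul_four_pow_add_mod_three (B 4 n), ← heq, h.attained.Ki_mod hi]

/-- Larger leading digits than `c` need not be compared, since all tails are below `𝓑(n)`. -/
lemma Ki_eq (h : Splits n) (hn : 2 ≤ n) {c t : ℕ} (ht : t ∈ tails 4 n (B 4 n)) (hc : 1 ≤ c)
    (hc' : c ≤ 3) (hi : (2 * c + t) % 3 = i)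
    (hmin : ∀ c' t', t' ∈ tails 4 n (B 4 n) → 1 ≤ c' → c' ≤ c → (2 * c' + t') % 3 = i →
      c' = c ∧ t ≤ t') : Ki 4 i n = c * cB 4 n + t := by
  refine le_antisymm (Ki_le_mul_cB_add ht hc hc' hi) ?_
  obtain ⟨c', hc₁, -, t', ht', hmod, heq⟩ := h.exists_Ki_eq hn (i := i) (by omega)
  rw [heq]
  rcases le_or_gt c' c with hle | hlt
  · obtain ⟨rfl, htt'⟩ := hmin c' t' ht' hc₁ hle hmod
    omega
  · have hmul : (c + 1) * cB 4 n ≤ c' * cB 4 n := Nat.mul_le_mul_right _ hlt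
    have htlt : t + 2 < cB 4 n := (tail_lt_pow (by norm_num) ht).trans (Nat.lt_succ_self _)
    rw [add_mul] at hmul
    omega

lemma Ki_add_four_le (h : Splits n) (hn : 2 ≤ n) (hi : i < 3) : Ki 4 i n + 4 ≤ 4 * cB 4 n := by
  obtain ⟨c, -, hc', t, ht, -, heq⟩ := h.exists_Ki_eq hn hi
  have := mul_add_tail_le hc' ht
  rw [pow_succ] at this
  unfold cB at heq ⊢
  omega

lemma exists_Ki_add_two_le (h : Splits n) : ∃ i < 3, Ki 4 i n + 2 ≤ cB 4 n + 3 * B 4 n := by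
  obtain ⟨t, ht⟩ := h.isLeadExponent.nonempty
  have hle := Ki_le_mul_cB_add ht le_rfl (by norm_num) rfl
  obtain ⟨t', htt', -⟩ := ht
  exact ⟨(2 * 1 + t) % 3, Nat.mod_lt _ (by norm_num), by omega⟩

lemma cB_add_cB_add_two_le (h : Splits n) (hn : 4 ≤ n) (hfloor : Splits (n / 2))
    (hceil : Splits ((n + 1) / 2)) : cB 4 (n / 2) + cB 4 ((n + 1) / 2) + 2 ≤ 3 * B 4 n := by
  obtain ⟨i, hi, hk⟩ := h.exists_splitSum_eq
  have hF := hfloor.cB_le (by omega) (hfloor.attained.F_Ki hi)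
  have hF' := hceil.cB_le (by omega)
    (hceil.attained.F_Ki (Nat.mod_lt (4 - i) (show 0 < 3 by norm_num)))
  unfold splitSum at hk
  omega

end Splits

/-! ### Small numbers of generators -/

lemma F_two : F 4 2 = 1 := by
  simpa [F_zero] using F_mul_add_of_lt (b := 4) (k := 0) (c := 1) (r := 0) (by norm_num)
    (by norm_num) (by norm_num) (by norm_num) (by norm_num)

lemma F_four : F 4 4 = 1 := by
  simpa [F_zero] using F_mul_add_of_lt (b := 4) (k := 0) (c := 2) (r := 0) (by norm_num)
    (by norm_num) (by norm_num) (by norm_num) (by norm_num)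

lemma attained_one : Attained 1 := by
  intro i hi
  interval_cases i
  exacts [⟨0, F_zero 4, rfl⟩, ⟨4, F_four, rfl⟩, ⟨2, F_two, rfl⟩]

lemma Ki_zero_one (b : ℕ) : Ki b 0 1 = 0 := Nat.le_zero.1 (Nat.sInf_le ⟨F_zero b, rfl⟩)

lemma Ki_one_one : Ki 4 1 1 = 4 := by
  have hle := Ki_le F_four (i := 1) rfl
  have hF := attained_one.F_Ki (i := 1) (by norm_num)
  have hmod := attained_one.Ki_mod (i := 1) (by norm_num)
  have hne : Ki 4 1 1 ≠ 1 := fun h => by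
    rw [h, F_one (by norm_num)] at hF
    omega
  omega

lemma Ki_two_one : Ki 4 2 1 = 2 := by
  have hle := Ki_le F_two (i := 2) rfl
  have hmod := attained_one.Ki_mod (i := 2) (by norm_num)
  omega

lemma splits_two : Splits 2 :=
  splits_of_attained le_rfl attained_one attained_one fun r hr hr' => by omega

lemma splitSum_two_eq {i : ℕ} (hi : i < 3) : splitSum 2 i = 4 := by
  interval_cases i <;> simp [splitSum, Ki_zero_one, Ki_one_one, Ki_two_one]

lemma B_two : B 4 2 = 2 := by
  obtain ⟨i, hi, hk⟩ := splits_two.exists_splitSum_eq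
  rw [splitSum_two_eq hi] at hk
  omega

lemma cB_two : cB 4 2 = 17 := by norm_num [cB, B_two]

lemma mem_tails_two_iff {t : ℕ} : t ∈ tails 4 2 (B 4 2) ↔ t = 0 ∨ t = 4 ∨ t = 2 := by
  constructor
  · intro ht
    have := splits_two.eq_Ki_of_mem_tails ht
    simp only [Nat.reduceDiv, Nat.reduceAdd, Ki_zero_one, Ki_one_one, Ki_two_one] at this
    omega
  · rw [splits_two.mem_tails_iff, B_two]
    rintro (rfl | rfl | rfl)
    exacts [⟨0, by norm_num, by rw [splitSum_two_eq]; norm_num, Or.inl (Ki_zero_one 4).symm⟩,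
      ⟨1, by norm_num, by rw [splitSum_two_eq]; norm_num, Or.inl Ki_one_one.symm⟩,
      ⟨2, by norm_num, by rw [splitSum_two_eq]; norm_num, Or.inl Ki_two_one.symm⟩]

lemma Ki_zero_two : Ki 4 0 2 = 21 := by
  rw [splits_two.Ki_eq le_rfl (c := 1) (t := 4) (mem_tails_two_iff.2 (by norm_num)) le_rfl
    (by norm_num) rfl fun c t ht hc hc' hi => by rw [mem_tails_two_iff] at ht; omega, cB_two]

lemma Ki_one_two : Ki 4 1 2 = 19 := by
  rw [splits_two.Ki_eq le_rfl (c := 1) (t := 2) (mem_tails_two_iff.2 (by norm_num)) le_rfl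
    (by norm_num) rfl fun c t ht hc hc' hi => by rw [mem_tails_two_iff] at ht; omega, cB_two]

lemma Ki_two_two : Ki 4 2 2 = 17 := by
  rw [splits_two.Ki_eq le_rfl (c := 1) (t := 0) (mem_tails_two_iff.2 (by norm_num)) le_rfl
    (by norm_num) rfl fun c t ht hc hc' hi => by rw [mem_tails_two_iff] at ht; omega, cB_two]

lemma splits_three : Splits 3 :=
  splits_of_attained (by norm_num) attained_one splits_two.attained fun r hr hr' => by omega

lemma splitSum_three :
    splitSum 3 0 = 19 ∧ splitSum 3 1 = 25 ∧ splitSum 3 2 = 19 := by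
  simp [splitSum, Ki_zero_one, Ki_one_one, Ki_two_one, Ki_zero_two, Ki_one_two, Ki_two_two]

lemma B_three : B 4 3 = 7 := by
  obtain ⟨h0, h1, h2⟩ := splitSum_three
  have hle := splits_three.three_mul_B_le (i := 0) (by norm_num)
  obtain ⟨i, hi, hk⟩ := splits_three.exists_splitSum_eq
  interval_cases i <;> omega

lemma mem_tails_three_iff {t : ℕ} :
    t ∈ tails 4 3 (B 4 3) ↔ t = 0 ∨ t = 19 ∨ t = 2 ∨ t = 17 := by
  obtain ⟨h0, h1, h2⟩ := splitSum_three
  constructor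
  · intro ht
    have := splits_three.eq_Ki_of_mem_tails ht
    simp only [Nat.reduceDiv, Nat.reduceAdd, B_three, Ki_zero_one, Ki_one_two, Ki_two_one,
      Ki_two_two] at this
    omega
  · rw [splits_three.mem_tails_iff, B_three]
    rintro (rfl | rfl | rfl | rfl)
    exacts [⟨0, by norm_num, by omega, Or.inl (Ki_zero_one 4).symm⟩,
      ⟨0, by norm_num, by omega, Or.inr Ki_one_two.symm⟩,
      ⟨2, by norm_num, by omega, Or.inl Ki_two_one.symm⟩,
      ⟨2, by norm_num, by omega, Or.inr Ki_two_two.symm⟩]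

lemma Ki_zero_three : Ki 4 0 3 = cB 4 3 + 19 := by
  rw [splits_three.Ki_eq (by norm_num) (c := 1) (t := 19) (mem_tails_three_iff.2 (by norm_num))
    le_rfl (by norm_num) rfl fun c t ht hc hc' hi => by rw [mem_tails_three_iff] at ht; omega,
    one_mul]

lemma Ki_one_three : Ki 4 1 3 = cB 4 3 + 2 := by
  rw [splits_three.Ki_eq (by norm_num) (c := 1) (t := 2) (mem_tails_three_iff.2 (by norm_num))
    le_rfl (by norm_num) rfl fun c t ht hc hc' hi => by rw [mem_tails_three_iff] at ht; omega,
    one_mul]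

lemma Ki_two_three : Ki 4 2 3 = cB 4 3 := by
  rw [splits_three.Ki_eq (by norm_num) (c := 1) (t := 0) (mem_tails_three_iff.2 (by norm_num))
    le_rfl (by norm_num) rfl fun c t ht hc hc' hi => by rw [mem_tails_three_iff] at ht; omega,
    one_mul, add_zero]

/-! ### Growth of the leading exponents -/

lemma sixteen_mul_cB_le_of_B_add_two_le {m n : ℕ} (h : B 4 m + 2 ≤ B 4 n) :
    16 * cB 4 m ≤ cB 4 n + 15 := by
  have := Nat.pow_le_pow_right (n := 4) (by norm_num) h
  rw [pow_add] at this
  unfold cB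
  omega

lemma six_mul_add_four_le_four_pow {k : ℕ} (hk : 2 ≤ k) : 6 * k + 4 ≤ 4 ^ k := by
  induction k, hk using Nat.le_induction with
  | base => norm_num
  | succ k _ ih => rw [pow_succ]; omega

lemma splits_of_lt {n : ℕ} (hn : 4 ≤ n)
    (ih : ∀ m, 2 ≤ m → m < n → Splits m ∧ ∀ l, 2 ≤ l → l < m → B 4 l + 2 ≤ B 4 m) :
    Splits n := by
  have hfloor := (ih (n / 2) (by omega) (by omega)).1
  have hceil := (ih ((n + 1) / 2) (by omega) (by omega)).1
  refine splits_of_attained (by omega) hfloor.attained hceil.attained fun r hr hr' => ?_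
  have hcB := sixteen_mul_cB_le_of_B_add_two_le ((ih _ (by omega) hr').2 _ (by omega) hr)
  have hle := (ih _ (by omega) hr').1.cB_le (by omega) rfl
  have hKf := hfloor.Ki_add_four_le (i := 2) (by omega) (by norm_num)
  have hKc := hceil.Ki_add_four_le (i := 2) (by omega) (by norm_num)
  have hmono : cB 4 (n / 2) ≤ cB 4 ((n + 1) / 2) := by
    obtain h | h : (n + 1) / 2 = n / 2 ∨ n / 2 < (n + 1) / 2 := by omega
    · rw [h]
    · have := sixteen_mul_cB_le_of_B_add_two_le
        ((ih ((n + 1) / 2) (by omega) (by omega)).2 _ (by omega) h)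
      have := two_le_cB (n / 2)
      omega
  rw [splitSum_two]
  omega

lemma B_two_mul_add_two_le {h : ℕ} (hh : 2 ≤ h) (hs : Splits h) (hs' : Splits (h + 1))
    (hd : Splits (2 * h)) (hd' : Splits (2 * h + 1)) (hB : B 4 h + 2 ≤ B 4 (h + 1)) :
    B 4 (2 * h) + 2 ≤ B 4 (2 * h + 1) := by
  have hfloor : 2 * h / 2 = h := by omega
  have hfloor' : (2 * h + 1) / 2 = h := by omega
  have hceil' : (2 * h + 1 + 1) / 2 = h + 1 := by omega
  have hupper := hd.three_mul_B_le (i := 2) (by norm_num)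
  have hlower := hd'.cB_add_cB_add_two_le (by omega) (by rwa [hfloor']) (by rwa [hceil'])
  rw [splitSum_two, hfloor, hfloor'] at hupper
  rw [hfloor', hceil'] at hlower
  have hK := hs.Ki_add_four_le (i := 2) hh (by norm_num)
  have hcB := sixteen_mul_cB_le_of_B_add_two_le hB
  have hpos := two_le_cB h
  omega

lemma B_two_mul_add_one_add_two_le {h : ℕ} (hh : 2 ≤ h) (hs : Splits h) (hs' : Splits (h + 1))
    (hd : Splits (2 * h + 1)) (hd' : Splits (2 * h + 2)) (hB : B 4 h + 2 ≤ B 4 (h + 1)) :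
    B 4 (2 * h + 1) + 2 ≤ B 4 (2 * h + 2) := by
  have hfloor : (2 * h + 1) / 2 = h := by omega
  have hceil : (2 * h + 1 + 1) / 2 = h + 1 := by omega
  have hfloor' : (2 * h + 2) / 2 = h + 1 := by omega
  have hceil' : (2 * h + 2 + 1) / 2 = h + 1 := by omega
  have hlower := hd'.cB_add_cB_add_two_le (by omega) (by rwa [hfloor']) (by rwa [hceil'])
  rw [hfloor', hceil'] at hlower
  obtain ⟨i, hi, hKi⟩ := hs'.exists_Ki_add_two_le
  have hupper := hd.three_mul_B_le (i := (4 - i) % 3) (Nat.mod_lt _ (by norm_num))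
  have hii : (4 - (4 - i) % 3) % 3 = i := by omega
  rw [splitSum, hfloor, hceil, hii] at hupper
  have hK := hs.Ki_add_four_le (i := (4 - i) % 3) hh (Nat.mod_lt _ (by norm_num))
  have hcB := sixteen_mul_cB_le_of_B_add_two_le hB
  have hpow := six_mul_add_four_le_four_pow (k := B 4 (h + 1)) (by omega)
  have hcB_eq : cB 4 (h + 1) = 4 ^ B 4 (h + 1) + 1 := rfl
  omega

lemma B_three_add_two_le (h : Splits 4) : B 4 3 + 2 ≤ B 4 4 := by
  have := h.cB_add_cB_add_two_le le_rfl splits_two splits_two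
  simp only [Nat.reduceDiv, Nat.reduceAdd, cB_two] at this
  rw [B_three]
  omega

lemma splits_and_B_add_two_le {n : ℕ} (hn : 2 ≤ n) :
    Splits n ∧ ∀ m, 2 ≤ m → m < n → B 4 m + 2 ≤ B 4 n := by
  induction n using Nat.strong_induction_on with
  | _ n ih =>
    obtain rfl | rfl | hn4 : n = 2 ∨ n = 3 ∨ 4 ≤ n := by omega
    · exact ⟨splits_two, by omega⟩
    · refine ⟨splits_three, fun m hm hm3 => ?_⟩
      obtain rfl : m = 2 := by omega
      norm_num [B_two, B_three]
    have hs : Splits n := splits_of_lt hn4 fun m hm hmn => ih m hmn hm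
    have hstep : B 4 (n - 1) + 2 ≤ B 4 n := by
      obtain ⟨h, rfl | rfl⟩ : ∃ h, n = 2 * h + 1 ∨ n = 2 * h + 2 := ⟨(n - 1) / 2, by omega⟩
      · obtain ⟨hs', hB⟩ := ih (h + 1) (by omega) (by omega)
        exact B_two_mul_add_two_le (by omega) (ih h (by omega) (by omega)).1 hs'
          (ih (2 * h) (by omega) (by omega)).1 hs (hB h (by omega) (by omega))
      · obtain rfl | hh : h = 1 ∨ 2 ≤ h := by omega
        · exact B_three_add_two_le hs
        · obtain ⟨hs', hB⟩ := ih (h + 1) (by omega) (by omega)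
          exact B_two_mul_add_one_add_two_le hh (ih h (by omega) (by omega)).1 hs'
            (ih (2 * h + 1) (by omega) (by omega)).1 hs (hB h (by omega) (by omega))
    refine ⟨hs, fun m hm hmn => ?_⟩
    obtain rfl | hlt : m = n - 1 ∨ m < n - 1 := by omega
    · exact hstep
    · have := (ih (n - 1) (by omega) (by omega)).2 m hm hlt
      omega

lemma splits {n : ℕ} (hn : 2 ≤ n) : Splits n := (splits_and_B_add_two_le hn).1

lemma sixteen_mul_cB_le {m n : ℕ} (hm : 2 ≤ m) (hmn : m < n) : 16 * cB 4 m ≤ cB 4 n + 15 :=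
  sixteen_mul_cB_le_of_B_add_two_le ((splits_and_B_add_two_le (by omega)).2 m hm hmn)

lemma attained {n : ℕ} (hn : 1 ≤ n) : Attained n := by
  obtain rfl | h : n = 1 ∨ 2 ≤ n := by omega
  exacts [attained_one, (splits h).attained]

lemma cB_le_Ki {n i : ℕ} (hn : 2 ≤ n) (hi : i < 3) : cB 4 n ≤ Ki 4 i n :=
  (splits hn).cB_le hn ((attained (by omega)).F_Ki hi)

lemma four_mul_Ki_lt_cB {m n i : ℕ} (hm : 2 ≤ m) (hmn : m < n) (hi : i < 3) :
    4 * Ki 4 i m < cB 4 n := by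
  have := (splits hm).Ki_add_four_le hm hi
  have := sixteen_mul_cB_le hm hmn
  omega

lemma Ki_lt_Ki {m n i j : ℕ} (hm : 2 ≤ m) (hmn : m < n) (hi : i < 3) (hj : j < 3) :
    Ki 4 i m < Ki 4 j n := by
  have := four_mul_Ki_lt_cB hm hmn hi
  have := cB_le_Ki (by omega : 2 ≤ n) hj
  omega

/-! ### The three ways of splitting -/

/-- All tails of `n` are congruent to `2` modulo `3`, and every `K_i(n)` continues with
`K_2(⌊n / 2⌋)`. -/
structure TwoSplit (n : ℕ) : Prop where
  zero : Ki 4 0 n = 2 * cB 4 n + Ki 4 2 (n / 2)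
  one : Ki 4 1 n = cB 4 n + Ki 4 2 (n / 2)
  two : Ki 4 2 n = 3 * cB 4 n + Ki 4 2 (n / 2)

/-- The tails of `n` are `K_0(p)` and `K_1(q)`, where `p` and `q` are the two halves of `n`. -/
structure ZeroOneSplit (n p q : ℕ) : Prop where
  zero : Ki 4 0 n = cB 4 n + Ki 4 1 q
  one : Ki 4 1 n = 2 * cB 4 n + Ki 4 0 p
  two : Ki 4 2 n = cB 4 n + Ki 4 0 p

lemma twoSplit_of_splitSum_lt {n : ℕ} (hn : 4 ≤ n) (h0 : splitSum n 2 < splitSum n 0)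
    (h1 : splitSum n 2 < splitSum n 1) : TwoSplit n := by
  have hs := splits (by omega : 2 ≤ n)
  have hle := hs.three_mul_B_le (i := 2) (by norm_num)
  obtain ⟨i, hi, hk⟩ := hs.exists_splitSum_eq
  obtain rfl : i = 2 := by interval_cases i <;> omega
  have hmem : Ki 4 2 (n / 2) ∈ tails 4 n (B 4 n) :=
    hs.mem_tails_iff.2 ⟨2, by norm_num, hk, Or.inl rfl⟩
  have htails {t : ℕ} (ht : t ∈ tails 4 n (B 4 n)) : t % 3 = 2 ∧ Ki 4 2 (n / 2) ≤ t := by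
    have hfloor := hs.attained_floor.Ki_mod (i := 2) (by norm_num)
    have hceil := hs.attained_ceil.Ki_mod (i := 2) (by norm_num)
    have hmono : Ki 4 2 (n / 2) ≤ Ki 4 2 ((n + 1) / 2) := by
      obtain h | h : (n + 1) / 2 = n / 2 ∨ n / 2 < (n + 1) / 2 := by omega
      · rw [h]
      · exact (Ki_lt_Ki (by omega) h (by norm_num) (by norm_num)).le
    have := hs.eq_Ki_of_mem_tails ht
    omega
  have hmod := (htails hmem).1
  have hKi {c i : ℕ} (hc : 1 ≤ c) (hc' : c ≤ 3) (hi : (2 * c + 2) % 3 = i) :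
      Ki 4 i n = c * cB 4 n + Ki 4 2 (n / 2) :=
    hs.Ki_eq (by omega) hmem hc hc' (by omega) fun c' t' ht' _ _ _ => by
      have := htails ht'
      omega
  exact ⟨hKi (by norm_num) (by norm_num) rfl, by simpa using hKi le_rfl (by norm_num) rfl,
    hKi (by norm_num) le_rfl rfl⟩

lemma zeroOneSplit_of_mem_tails_iff {n p q : ℕ} (hn : 2 ≤ n) (hp : 1 ≤ p) (hq : 1 ≤ q)
    (htails : ∀ t, t ∈ tails 4 n (B 4 n) ↔ t = Ki 4 0 p ∨ t = Ki 4 1 q) :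
    ZeroOneSplit n p q := by
  have hmod₀ := (attained hp).Ki_mod (i := 0) (by norm_num)
  have hmod₁ := (attained hq).Ki_mod (i := 1) (by norm_num)
  have hmem₀ : Ki 4 0 p ∈ tails 4 n (B 4 n) := (htails _).2 (Or.inl rfl)
  have hmem₁ : Ki 4 1 q ∈ tails 4 n (B 4 n) := (htails _).2 (Or.inr rfl)
  have hs := splits hn
  constructor
  · rw [hs.Ki_eq hn hmem₁ le_rfl (by norm_num) (by omega) fun c' t' ht' _ _ _ => by
      rw [htails] at ht'; omega, one_mul]
  · rw [hs.Ki_eq hn hmem₀ (c := 2) (by norm_num) (by norm_num) (by omega) fun c' t' ht' _ _ _ => by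
      rw [htails] at ht'; omega]
  · rw [hs.Ki_eq hn hmem₀ le_rfl (by norm_num) (by omega) fun c' t' ht' _ _ _ => by
      rw [htails] at ht'; omega, one_mul]

lemma zeroOneSplit_floor_of_splitSum_lt {n : ℕ} (hn : 2 ≤ n)
    (h1 : splitSum n 0 < splitSum n 1 ∨ (n + 1) / 2 = n / 2)
    (h2 : splitSum n 0 < splitSum n 2) : ZeroOneSplit n (n / 2) ((n + 1) / 2) := by
  have hs := splits hn
  have hle := hs.three_mul_B_le (i := 0) (by norm_num)
  have hk : splitSum n 0 + 2 = 3 * B 4 n := by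
    obtain ⟨i, hi, hk⟩ := hs.exists_splitSum_eq
    rcases h1 with h1 | h1
    · interval_cases i <;> omega
    · have hsymm : splitSum n 1 = splitSum n 0 := by
        rw [splitSum_zero, splitSum_one, h1, add_comm]
      interval_cases i <;> omega
  refine zeroOneSplit_of_mem_tails_iff hn (by omega) (by omega) fun t => ⟨fun ht => ?_, fun ht =>
    hs.mem_tails_iff.2 ⟨0, by norm_num, hk, ht⟩⟩
  obtain ⟨-, h⟩ | ⟨hk', h⟩ | ⟨hk', -⟩ := hs.eq_Ki_of_mem_tails ht
  · exact h
  · rcases h1 with h1 | h1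
    · omega
    · rw [h1] at h ⊢
      exact h.symm
  · omega

lemma zeroOneSplit_ceil_of_splitSum_lt {n : ℕ} (hn : 2 ≤ n) (h0 : splitSum n 1 < splitSum n 0)
    (h2 : splitSum n 1 < splitSum n 2) : ZeroOneSplit n ((n + 1) / 2) (n / 2) := by
  have hs := splits hn
  have hle := hs.three_mul_B_le (i := 1) (by norm_num)
  obtain ⟨i, hi, hk⟩ := hs.exists_splitSum_eq
  obtain rfl : i = 1 := by interval_cases i <;> omega
  refine zeroOneSplit_of_mem_tails_iff hn (by omega) (by omega) fun t => ⟨fun ht => ?_, fun ht =>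
    hs.mem_tails_iff.2 ⟨1, by norm_num, hk, ht.symm⟩⟩
  have := hs.eq_Ki_of_mem_tails ht
  omega

lemma TwoSplit.zeroOneSplit_floor {n : ℕ} (hn : 4 ≤ n) (h : TwoSplit ((n + 1) / 2)) :
    ZeroOneSplit n (n / 2) ((n + 1) / 2) := by
  obtain ⟨h0, h1, h2⟩ := h
  have hpos := two_le_cB ((n + 1) / 2)
  obtain heq | hlt : (n + 1) / 2 = n / 2 ∨ n / 2 < (n + 1) / 2 := by omega
  · refine zeroOneSplit_floor_of_splitSum_lt (by omega) (Or.inr heq) ?_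
    rw [splitSum_zero, splitSum_two, ← heq]
    omega
  · have hsmall := four_mul_Ki_lt_cB (i := 0) (by omega) hlt (by norm_num)
    apply zeroOneSplit_floor_of_splitSum_lt (by omega) (Or.inl _)
    all_goals
      simp only [splitSum_zero, splitSum_one, splitSum_two]
      omega

lemma TwoSplit.zeroOneSplit_four_mul_add_one {D : ℕ} (hD : 2 ≤ D) (h : TwoSplit (D + 1))
    (h' : TwoSplit (2 * D)) : ZeroOneSplit (4 * D + 1) (2 * D + 1) (2 * D) := by
  have hfloor : (4 * D + 1) / 2 = 2 * D := by omega
  have hceil : (4 * D + 1 + 1) / 2 = 2 * D + 1 := by omega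
  have hhalf : (2 * D + 1 + 1) / 2 = D + 1 := by omega
  obtain ⟨h0, h1, h2⟩ := h'
  obtain ⟨k0, k1, k2⟩ := TwoSplit.zeroOneSplit_floor (n := 2 * D + 1) (by omega) (by rwa [hhalf])
  rw [hhalf] at k0
  have hsmall := four_mul_Ki_lt_cB (i := 1) (show 2 ≤ D + 1 by omega)
    (show D + 1 < 2 * D by omega) (by norm_num)
  have hsplit : ZeroOneSplit (4 * D + 1) ((4 * D + 1 + 1) / 2) ((4 * D + 1) / 2) := by
    apply zeroOneSplit_ceil_of_splitSum_lt (by omega)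
    all_goals
      simp only [splitSum_zero, splitSum_one, splitSum_two, hfloor, hceil]
      omega
  rwa [hfloor, hceil] at hsplit

lemma twoSplit_of_zeroOneSplit {n p q p' q' : ℕ} (hn : 4 ≤ n)
    (h : ZeroOneSplit (n / 2) p q) (h' : ZeroOneSplit ((n + 1) / 2) p' q')
    (hp : 2 ≤ p) (hpn : p < n / 2) (hp' : 2 ≤ p') (hpn' : p' < n / 2) : TwoSplit n := by
  have hsmall := four_mul_Ki_lt_cB (i := 0) hp hpn (by norm_num)
  have hsmall' := four_mul_Ki_lt_cB (i := 0) hp' hpn' (by norm_num)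
  obtain ⟨h0, h1, h2⟩ := h
  obtain ⟨k0, k1, k2⟩ := h'
  obtain heq | hlt : (n + 1) / 2 = n / 2 ∨ n / 2 < (n + 1) / 2 := by omega
  · rw [heq] at k0 k1 k2
    apply twoSplit_of_splitSum_lt hn
    all_goals
      simp only [splitSum_zero, splitSum_one, splitSum_two, heq]
      omega
  · have hgap := four_mul_Ki_lt_cB (i := 2) (by omega) hlt (by norm_num)
    apply twoSplit_of_splitSum_lt hn
    all_goals
      simp only [splitSum_zero, splitSum_one, splitSum_two]
      omega

lemma twoSplit_four : TwoSplit 4 := by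
  apply twoSplit_of_splitSum_lt le_rfl <;>
    norm_num [splitSum, Ki_zero_two, Ki_one_two, Ki_two_two]

lemma cB_three : cB 4 3 = 16385 := by norm_num [cB, B_three]

lemma twoSplit_five : TwoSplit 5 := by
  apply twoSplit_of_splitSum_lt (by norm_num) <;>
    norm_num [splitSum, Ki_zero_two, Ki_one_two, Ki_two_two, Ki_zero_three, Ki_one_three,
      Ki_two_three, cB_three]

lemma twoSplit_six : TwoSplit 6 := by
  apply twoSplit_of_splitSum_lt (by norm_num) <;>
    norm_num [splitSum, Ki_zero_three, Ki_one_three, Ki_two_three, cB_three]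

/-! ### The ranges delimited by `δ_d` and `δ_{d+1}` -/

lemma three_mul_delta (d : ℕ) : 3 * delta d + 1 = 10 * 4 ^ d := by
  have := mul_four_pow_add_mod_three d 1 0
  unfold delta
  omega

lemma delta_zero : delta 0 = 3 := rfl

lemma delta_succ (d : ℕ) : delta (d + 1) = 4 * delta d + 1 := by
  have := three_mul_delta d
  have := three_mul_delta (d + 1)
  rw [pow_succ] at this
  omega

lemma three_le_delta (d : ℕ) : 3 ≤ delta d := by
  induction d with
  | zero => rfl
  | succ d ih => rw [delta_succ]; omega

lemma twoSplit_of_le_two_mul_delta {d n : ℕ} (hl : delta d < n) (hr : n ≤ 2 * delta d) :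
    TwoSplit n := by
  induction d generalizing n with
  | zero =>
    rw [delta_zero] at hl hr
    interval_cases n
    exacts [twoSplit_four, twoSplit_five, twoSplit_six]
  | succ d ih =>
    rw [delta_succ] at hl hr
    have hδ := three_le_delta d
    have hhalf {m : ℕ} (hm : 2 * delta d < m) (hm' : m ≤ 4 * delta d + 1) :
        ∃ p q, ZeroOneSplit m p q ∧ m / 2 ≤ p ∧ p ≤ (m + 1) / 2 := by
      obtain rfl | hlt : m = 4 * delta d + 1 ∨ m ≤ 4 * delta d := by omega
      · exact ⟨_, _, TwoSplit.zeroOneSplit_four_mul_add_one (by omega)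
          (ih (by omega) (by omega)) (ih (by omega) le_rfl), by omega, by omega⟩
      · exact ⟨_, _, TwoSplit.zeroOneSplit_floor (by omega) (ih (by omega) (by omega)), le_rfl,
          by omega⟩
    obtain ⟨p, q, hs, hp, hp'⟩ := hhalf (m := n / 2) (by omega) (by omega)
    obtain ⟨p', q', hs', hq, hq'⟩ := hhalf (m := (n + 1) / 2) (by omega) (by omega)
    exact twoSplit_of_zeroOneSplit (by omega) hs hs' (by omega) (by omega) (by omega) (by omega)

lemma zeroOneSplit_of_le_four_mul_delta {d n : ℕ} (hl : 2 * delta d < n) (hr : n ≤ 4 * delta d) :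
    ZeroOneSplit n (n / 2) ((n + 1) / 2) := by
  have := three_le_delta d
  exact TwoSplit.zeroOneSplit_floor (by omega)
    (twoSplit_of_le_two_mul_delta (d := d) (by omega) (by omega))

lemma zeroOneSplit_delta_succ (d : ℕ) :
    ZeroOneSplit (delta (d + 1)) (2 * delta d + 1) (2 * delta d) := by
  have := three_le_delta d
  rw [delta_succ]
  exact TwoSplit.zeroOneSplit_four_mul_add_one (by omega)
    (twoSplit_of_le_two_mul_delta (d := d) (by omega) (by omega))
    (twoSplit_of_le_two_mul_delta (d := d) (by omega) le_rfl)

lemma odd_delta (d : ℕ) : Odd (delta d) := by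
  have := three_mul_delta d
  rw [Nat.odd_iff]
  omega

lemma mem_idx_four {i : ℕ} : i ∈ idx 4 ↔ i < 3 := by
  have hodd : ¬Odd 4 := by decide
  simp only [idx, Set.mem_ofPred_eq, hodd, false_imp_iff, and_true, Nat.add_one_sub_one]

/-! ### Leading terms of `K_i(n)` -/

lemma Ki_mem_OB {n i : ℕ} (hn : 1 ≤ n) (hi : i < 3) : Ki 4 i n ∈ OB 4 n := by
  induction n using Nat.strong_induction_on generalizing i with
  | h n ih =>
    obtain rfl | hn₂ : n = 1 ∨ 2 ≤ n := by omega
    · exact Ki_one_mem_OB (mem_idx_four.2 hi)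
    obtain ⟨c, hc, hc', t, ht, -, heq⟩ := (splits hn₂).exists_Ki_eq hn₂ hi
    have hc₄ : c ≤ if Even 4 then 4 - 1 else (4 - 1) / 2 := by
      rwa [if_pos (by decide)]
    obtain ⟨m, j, hhalf, hj, rfl⟩ :
        ∃ m j, (m = n / 2 ∨ m = (n + 1) / 2) ∧ j < 3 ∧ t = Ki 4 j m := by
      obtain ⟨j, hj, -, rfl | rfl⟩ := (splits hn₂).mem_tails_iff.1 ht
      exacts [⟨_, _, Or.inl rfl, hj, rfl⟩, ⟨_, _, Or.inr rfl, Nat.mod_lt _ (by norm_num), rfl⟩]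
    rw [heq]
    obtain rfl | hm : m = 1 ∨ 2 ≤ m := by omega
    · exact mul_cB_add_Ki_one_mem_OB hc hc₄ (by omega) (mem_idx_four.2 hj)
    · exact mul_cB_add_mem_OB hc hc₄ hm (by omega) hhalf (ih m (by omega) (by omega) hj)

lemma hasLeadingTerms_of_eq {u a n a' n' m i j : ℕ} (hu : u = a * cB 4 n + Ki 4 j n')
    (hj : Ki 4 j n' = a' * cB 4 n' + Ki 4 i m) (hm : 1 ≤ m) (hi : i < 3) :
    HasLeadingTerms 4 u a n a' n' m :=
  ⟨_, Ki_mem_OB hm hi, by rw [hu, hj, add_assoc]⟩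

lemma TwoSplit.hasLeadingTerms {n a m i : ℕ} (h : TwoSplit n)
    (htail : Ki 4 2 (n / 2) = a * cB 4 (n / 2) + Ki 4 i m) (hm : 1 ≤ m) (hi : i < 3) :
    HasLeadingTerms 4 (Ki 4 0 n) 2 n a (n / 2) m ∧
      HasLeadingTerms 4 (Ki 4 1 n) 1 n a (n / 2) m ∧
      HasLeadingTerms 4 (Ki 4 2 n) 3 n a (n / 2) m :=
  ⟨hasLeadingTerms_of_eq h.zero htail hm hi,
    hasLeadingTerms_of_eq (by rw [h.one, one_mul]) htail hm hi,
    hasLeadingTerms_of_eq h.two htail hm hi⟩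

lemma ZeroOneSplit.hasLeadingTerms {n p q a a' m m' i i' : ℕ} (h : ZeroOneSplit n p q)
    (hq : Ki 4 1 q = a * cB 4 q + Ki 4 i m) (hm : 1 ≤ m) (hi : i < 3)
    (hp : Ki 4 0 p = a' * cB 4 p + Ki 4 i' m') (hm' : 1 ≤ m') (hi' : i' < 3) :
    HasLeadingTerms 4 (Ki 4 0 n) 1 n a q m ∧
      HasLeadingTerms 4 (Ki 4 1 n) 2 n a' p m' ∧
      HasLeadingTerms 4 (Ki 4 2 n) 1 n a' p m' :=
  ⟨hasLeadingTerms_of_eq (by rw [h.zero, one_mul]) hq hm hi,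
    hasLeadingTerms_of_eq h.one hp hm' hi',
    hasLeadingTerms_of_eq (by rw [h.two, one_mul]) hp hm' hi'⟩

lemma Ki_two_half_eq {d n : ℕ} (hl : delta d < n) (hr : n ≤ 2 * delta d) :
    Ki 4 2 (n / 2) = 1 * cB 4 (n / 2) +
      Ki 4 0 (if 1 ≤ d ∧ n = 2 * delta d then (n + 3) / 4 else n / 4) := by
  rw [one_mul]
  rcases d with _ | d
  · rw [delta_zero] at hl hr
    rw [if_neg (by omega), show n / 4 = 1 by omega, Ki_zero_one, add_zero]
    obtain h | h : n / 2 = 2 ∨ n / 2 = 3 := by omega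
    · rw [h, Ki_two_two, cB_two]
    · rw [h, Ki_two_three]
  · have hsucc := delta_succ d
    by_cases h : n = 2 * delta (d + 1)
    · rw [if_pos ⟨by omega, h⟩, show n / 2 = delta (d + 1) by omega,
        (zeroOneSplit_delta_succ d).two, show (n + 3) / 4 = 2 * delta d + 1 by omega]
    · rw [if_neg (by tauto),
        (zeroOneSplit_of_le_four_mul_delta (d := d) (by omega) (by omega)).two,
        Nat.div_div_eq_div_mul]

lemma Ki_one_half_eq {d n : ℕ} (hl : delta d < (n + 1) / 2) (hr : (n + 1) / 2 ≤ 2 * delta d) :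
    Ki 4 1 ((n + 1) / 2) = 1 * cB 4 ((n + 1) / 2) + Ki 4 2 ((n + 1) / 4) := by
  rw [(twoSplit_of_le_two_mul_delta hl hr).one, one_mul, Nat.div_div_eq_div_mul]

lemma exists_Ki_zero_half_eq {d n : ℕ} (hl : 2 * delta d < n) (hr : n ≤ 4 * delta d) :
    ∃ i < 3, Ki 4 0 (n / 2) = (if n = 2 * delta d + 1 then 1 else 2) * cB 4 (n / 2) +
      Ki 4 i (if n = 7 then 2 else n / 4) := by
  by_cases h : n = 2 * delta d + 1
  · refine ⟨1, by norm_num, ?_⟩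
    rw [if_pos h, one_mul, show n / 2 = delta d by omega]
    rcases d with _ | d
    · rw [delta_zero] at h ⊢
      rw [if_pos h, Ki_zero_three, Ki_one_two]
    · have hδ := three_le_delta d
      have hsucc := delta_succ d
      rw [if_neg (by omega), (zeroOneSplit_delta_succ d).zero,
        show n / 4 = 2 * delta d by omega]
  · have h7 : n ≠ 7 := by
      have hδ := three_le_delta d
      omega
    refine ⟨2, by norm_num, ?_⟩
    rw [if_neg h, if_neg h7, (twoSplit_of_le_two_mul_delta (d := d) (by omega) (by omega)).zero,
      Nat.div_div_eq_div_mul]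

lemma hasLeadingTerms_of_le_two_mul_delta {d n : ℕ} (hl : delta d < n) (hr : n ≤ 2 * delta d) :
    ∃ m, m = (if 1 ≤ d ∧ n = 2 * delta d then (n + 3) / 4 else n / 4) ∧
      HasLeadingTerms 4 (Ki 4 0 n) 2 n 1 (n / 2) m ∧
      HasLeadingTerms 4 (Ki 4 1 n) 1 n 1 (n / 2) m ∧
      HasLeadingTerms 4 (Ki 4 2 n) 3 n 1 (n / 2) m := by
  have hδ := three_le_delta d
  exact ⟨_, rfl, (twoSplit_of_le_two_mul_delta hl hr).hasLeadingTerms (Ki_two_half_eq hl hr)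
    (by split_ifs <;> omega) (by norm_num)⟩

lemma hasLeadingTerms_of_le_four_mul_delta {d n : ℕ} (hl : 2 * delta d < n)
    (hr : n ≤ 4 * delta d) :
    ∃ a m, a = (if n = 2 * delta d + 1 then 1 else 2) ∧ m = (if n = 7 then 2 else n / 4) ∧
      HasLeadingTerms 4 (Ki 4 0 n) 1 n 1 ((n + 1) / 2) ((n + 1) / 4) ∧
      HasLeadingTerms 4 (Ki 4 1 n) 2 n a (n / 2) m ∧
      HasLeadingTerms 4 (Ki 4 2 n) 1 n a (n / 2) m := by
  have hδ := three_le_delta d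
  obtain ⟨i, hi, htail⟩ := exists_Ki_zero_half_eq hl hr
  exact ⟨_, _, rfl, rfl, (zeroOneSplit_of_le_four_mul_delta hl hr).hasLeadingTerms
    (Ki_one_half_eq (d := d) (by omega) (by omega)) (by omega) (by norm_num)
    htail (by split_ifs <;> omega) hi⟩

lemma hasLeadingTerms_delta_succ {d n : ℕ} (hn : n = delta (d + 1)) :
    HasLeadingTerms 4 (Ki 4 0 n) 1 n 1 (n / 2) (n / 4) ∧
      HasLeadingTerms 4 (Ki 4 1 n) 2 n 1 ((n + 1) / 2) ((n + 3) / 4) ∧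
      HasLeadingTerms 4 (Ki 4 2 n) 1 n 1 ((n + 1) / 2) ((n + 3) / 4) := by
  have hδ := three_le_delta d
  have hsplit := zeroOneSplit_delta_succ d
  rw [← hn] at hsplit
  rw [delta_succ] at hn
  rw [show n / 2 = 2 * delta d by omega, show (n + 1) / 2 = 2 * delta d + 1 by omega,
    show n / 4 = 2 * delta d / 2 by omega, show (n + 3) / 4 = (2 * delta d + 1 + 1) / 2 by omega]
  refine hsplit.hasLeadingTerms ?_ (i := 2) (by omega) (by norm_num) ?_ (i' := 1) (by omega)
    (by norm_num)
  · rw [(twoSplit_of_le_two_mul_delta (d := d) (by omega) le_rfl).one, one_mul]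
  · rw [(zeroOneSplit_of_le_four_mul_delta (d := d) (by omega) (by omega)).zero, one_mul]

/-! ### The generalized Thue–Morse sequence -/

lemma tau_eq {n t : ℕ} (hn : 1 ≤ n) (ht : t < 3) (hle : ∀ i < 3, Ki 4 t n ≤ Ki 4 i n) :
    tau 4 n = t := by
  have ha := attained hn
  have hF : F 4 (K 4 n) = n := Nat.sInf_mem (s := {u | F 4 u = n}) ⟨_, ha.F_Ki ht⟩
  have hK : K 4 n = Ki 4 t n :=
    le_antisymm (K_le (ha.F_Ki ht)) ((hle _ (Nat.mod_lt _ (by norm_num))).trans (Ki_le hF rfl))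
  have hset : {s : ℕ | if Even 4 then s ∈ idx 4 ∧ K 4 n = Ki 4 s n
      else 2 * s ∈ idx 4 ∧ K 4 n = Ki 4 (2 * s) n} = {t} := by
    ext s
    simp only [if_pos (show Even 4 by decide), Set.mem_ofPred_eq, Set.mem_singleton_iff,
      mem_idx_four]
    refine ⟨fun ⟨hs, h⟩ => ?_, fun hs => hs ▸ ⟨ht, hK⟩⟩
    rw [← ha.Ki_mod hs, ← h, hK, ha.Ki_mod ht]
  rw [tau, hset, csInf_singleton]

lemma TwoSplit.tau_eq_one {n : ℕ} (h : TwoSplit n) (hn : 1 ≤ n) : tau 4 n = 1 := by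
  obtain ⟨h0, h1, h2⟩ := h
  refine tau_eq hn (by norm_num) fun i hi => ?_
  interval_cases i <;> omega

lemma ZeroOneSplit.tau_eq_two {n p q : ℕ} (h : ZeroOneSplit n p q) (hn : 1 ≤ n)
    (hpq : Ki 4 0 p ≤ Ki 4 1 q) : tau 4 n = 2 := by
  obtain ⟨h0, h1, h2⟩ := h
  refine tau_eq hn (by norm_num) fun i hi => ?_
  interval_cases i <;> omega

lemma ZeroOneSplit.tau_eq_zero {n p q : ℕ} (h : ZeroOneSplit n p q) (hn : 1 ≤ n)
    (hqp : Ki 4 1 q ≤ Ki 4 0 p) : tau 4 n = 0 := by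
  obtain ⟨h0, h1, h2⟩ := h
  refine tau_eq hn (by norm_num) fun i hi => ?_
  interval_cases i <;> omega

lemma tau_eq_one_of_le_two_mul_delta {d n : ℕ} (hl : delta d < n) (hr : n ≤ 2 * delta d) :
    tau 4 n = 1 :=
  (twoSplit_of_le_two_mul_delta hl hr).tau_eq_one (by omega)

lemma tau_eq_two_of_odd {d n : ℕ} (hl : 2 * delta d < n) (hr : n ≤ 4 * delta d) (hn : Odd n) :
    tau 4 n = 2 := by
  have hδ := three_le_delta d
  rw [Nat.odd_iff] at hn
  exact (zeroOneSplit_of_le_four_mul_delta hl hr).tau_eq_two (by omega)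
    (Ki_lt_Ki (by omega) (by omega) (by norm_num) (by norm_num)).le

lemma tau_eq_zero_of_even {d n : ℕ} (hl : 2 * delta d < n) (hr : n ≤ 4 * delta d) (hn : Even n) :
    tau 4 n = 0 := by
  rw [Nat.even_iff] at hn
  refine (zeroOneSplit_of_le_four_mul_delta hl hr).tau_eq_zero (by omega) ?_
  obtain ⟨h0, h1, -⟩ := twoSplit_of_le_two_mul_delta (d := d) (n := n / 2) (by omega) (by omega)
  rw [show (n + 1) / 2 = n / 2 by omega]
  omega

lemma tau_delta_succ (d : ℕ) : tau 4 (delta (d + 1)) = 0 := by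
  have hδ := three_le_delta d
  exact (zeroOneSplit_delta_succ d).tau_eq_zero (by rw [delta_succ]; omega)
    (Ki_lt_Ki (by omega) (by omega) (by norm_num) (by norm_num)).le

lemma tau_one : tau 4 1 = 0 :=
  tau_eq le_rfl (by norm_num) fun i _ => by rw [Ki_zero_one]; exact Nat.zero_le _

lemma tau_two : tau 4 2 = 2 := by
  refine tau_eq (by norm_num) (by norm_num) fun i hi => ?_
  interval_cases i <;> simp only [Ki_zero_two, Ki_one_two, Ki_two_two] <;> norm_num

lemma tau_three : tau 4 3 = 2 := by
  refine tau_eq (by norm_num) (by norm_num) fun i hi => ?_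
  interval_cases i <;> simp only [Ki_zero_three, Ki_one_three, Ki_two_three] <;> omega

lemma map_range'_eq_replicate {α : Type*} {g : ℕ → α} {s k : ℕ} {x : α}
    (h : ∀ i < k, g (s + i) = x) : (List.range' s k).map g = List.replicate k x := by
  refine List.eq_replicate_iff.2 ⟨by simp, fun y hy => ?_⟩
  obtain ⟨n, hn, rfl⟩ := List.mem_map.1 hy
  obtain ⟨hsn, hns⟩ := List.mem_range'_1.1 hn
  rw [← h (n - s) (by omega), Nat.add_sub_cancel' hsn]

lemma map_range'_eq_flatten_replicate {α : Type*} {g : ℕ → α} {s k : ℕ} {x y : α}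
    (h : ∀ i < k, g (s + 2 * i) = x ∧ g (s + 2 * i + 1) = y) :
    (List.range' s (2 * k)).map g = (List.replicate k [x, y]).flatten := by
  induction k generalizing s with
  | zero => rfl
  | succ k ih =>
    obtain ⟨hx, hy⟩ := h 0 (by omega)
    have htail := ih (s := s + 2) fun i hi => by
      simpa only [mul_add, add_assoc, add_comm 2] using h (i + 1) (by omega)
    rw [mul_add_one, List.range'_succ, List.range'_succ, List.map_cons, List.map_cons,
      List.replicate_succ, List.flatten_cons, ← htail]
    exact congrArg₂ (fun u v => u :: v :: _) hx hy

lemma map_tau_range'_eq_block (j : ℕ) :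
    (List.range' (1 + delta j) (delta j + 2 * delta j + 1)).map (tau 4) = block j := by
  have hodd := Nat.odd_iff.1 (odd_delta j)
  rw [← List.range'_append_1, ← List.range'_append_1, List.map_append, List.map_append, block]
  congr 2
  · exact map_range'_eq_replicate fun i hi =>
      tau_eq_one_of_le_two_mul_delta (d := j) (by omega) (by omega)
  · exact map_range'_eq_flatten_replicate fun i hi =>
      ⟨tau_eq_two_of_odd (d := j) (by omega) (by omega) (Nat.odd_iff.2 (by omega)),
        tau_eq_zero_of_even (d := j) (by omega) (by omega) (Nat.even_iff.2 (by omega))⟩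
  · have hsucc := delta_succ j
    rw [List.range'_one, List.map_singleton,
      show 1 + delta j + (delta j + 2 * delta j) = delta (j + 1) by omega, tau_delta_succ]

lemma map_tau_range' (j : ℕ) : (List.range' 1 (delta j)).map (tau 4) =
    [0, 2, 2] ++ (List.range j).flatMap block := by
  induction j with
  | zero => simp [delta_zero, List.range'_succ, tau_one, tau_two, tau_three]
  | succ j ih =>
    have hsucc := delta_succ j
    rw [show delta (j + 1) = delta j + (delta j + 2 * delta j + 1) by omega,
      ← List.range'_append_1, List.map_append, ih, map_tau_range'_eq_block, List.range_succ,
      List.flatMap_append, List.append_assoc, List.flatMap_singleton]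

end Kaprekar

open Kaprekar in
/-- All bounds on `n` are multiplied by `3`; `(n + 1) / 2` and `(n + 3) / 4` are
`⌈n/2⌉` and `⌈n/4⌉`. -/
theorem mainTheorem5 :
    (∀ d n : ℕ,
      -- first range
      (10 * 4 ^ d + 2 ≤ 3 * n → 3 * n < 20 * 4 ^ d + 1 →
        (∃ m, m = (if 1 ≤ d ∧ 3 * n + 2 = 20 * 4 ^ d then (n + 3) / 4 else n / 4) ∧
          HasLeadingTerms 4 (Ki 4 0 n) 2 n 1 (n / 2) m ∧
          HasLeadingTerms 4 (Ki 4 1 n) 1 n 1 (n / 2) m ∧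
          HasLeadingTerms 4 (Ki 4 2 n) 3 n 1 (n / 2) m) ∧
        tau 4 n = 1) ∧
      -- second range
      (20 * 4 ^ d + 1 ≤ 3 * n → 3 * n + 1 < 10 * 4 ^ (d + 1) →
        (∃ a m, a = (if 3 * n = 20 * 4 ^ d + 1 then 1 else 2) ∧
          m = (if n = 7 then 2 else n / 4) ∧
          HasLeadingTerms 4 (Ki 4 0 n) 1 n 1 ((n + 1) / 2) ((n + 1) / 4) ∧
          HasLeadingTerms 4 (Ki 4 1 n) 2 n a (n / 2) m ∧
          HasLeadingTerms 4 (Ki 4 2 n) 1 n a (n / 2) m) ∧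
        (Odd n → tau 4 n = 2) ∧ (Even n → tau 4 n = 0)) ∧
      -- the single value that ends the block
      (3 * n + 1 = 10 * 4 ^ (d + 1) →
        HasLeadingTerms 4 (Ki 4 0 n) 1 n 1 (n / 2) (n / 4) ∧
        HasLeadingTerms 4 (Ki 4 1 n) 2 n 1 ((n + 1) / 2) ((n + 3) / 4) ∧
        HasLeadingTerms 4 (Ki 4 2 n) 1 n 1 ((n + 1) / 2) ((n + 3) / 4) ∧
        tau 4 n = 0)) ∧
    -- the terms of index `1, …, δ_j`, for every `j`
    (∀ j : ℕ, (List.range' 1 (delta j)).map (tau 4) =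
      [0, 2, 2] ++ (List.range j).flatMap block) := by
  refine ⟨fun d n => ?_, map_tau_range'⟩
  have hδ := three_mul_delta d
  have hsucc := delta_succ d
  have htop : 3 * n + 2 = 20 * 4 ^ d ↔ n = 2 * delta d := by omega
  have hbottom : 3 * n = 20 * 4 ^ d + 1 ↔ n = 2 * delta d + 1 := by omega
  simp only [htop, hbottom]
  refine ⟨fun hl hr => ?_, fun hl hr => ?_, fun he => ?_⟩
  · have hl' : delta d < n := by omega
    have hr' : n ≤ 2 * delta d := by omega
    exact ⟨hasLeadingTerms_of_le_two_mul_delta hl' hr', tau_eq_one_of_le_two_mul_delta hl' hr'⟩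
  · have hl' : 2 * delta d < n := by omega
    have hr' : n ≤ 4 * delta d := by omega
    exact ⟨hasLeadingTerms_of_le_four_mul_delta hl' hr', tau_eq_two_of_odd hl' hr',
      tau_eq_zero_of_even hl' hr'⟩
  · obtain rfl : n = delta (d + 1) := by omega
    obtain ⟨h0, h1, h2⟩ := hasLeadingTerms_delta_succ (d := d) rfl
    exact ⟨h0, h1, h2, tau_delta_succ d⟩
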